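/- For $i\ge 1$ let $\mathfrak{g}_i$ be $\mathfrak{gl}(i)$, the complex $i\times i$ matrices, for all $i$, or $\mathfrak{so}(i)$, the complex skew-symmetric $i\times i$ matrices, for all $i$. Let $G_i=GL(i,\mathbb{C})$, respectively $G_i=SO(i,\mathbb{C})=\{g : g g^{T}=1,\ \det g=1\}$, act on $\mathfrak{g}_i$ by conjugation, and let $r_i$ be the rank of $\mathfrak{g}_i$, that is $r_i=i$, respectively $r_i=\lfloor i/2\rfloor$. Let $P(\mathfrak{g}_i)$ be the algebra of complex polynomial functions on $\mathfrak{g}_i$ and $P(\mathfrak{g}_i)^{G_i}$ its subalgebra of $G_i$-invariant functions. For $x\in\mathfrak{g}_n$ and $1\le i\le n$ let $x_i\in\mathfrak{g}_i$ be the upper left $i\times i$ corner of $x$; a function $f$ on $\mathfrak{g}_i$ is regarded as the function $x\mapsto f(x_i)$ on $\mathfrak{g}_n$. Suppose that, for each $1\le i\le n$, the polynomials $f_{i,1},\dots,f_{i,r_i}$ generate the $\mathbb{C}$-algebra $P(\mathfrak{g}_i)^{G_i}$. Then the functions $f_{i,j}$ ($1\le i\le n$, $1\le j\le r_i$) on $\mathfrak{g}_n$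 are algebraically independent over $\mathbb{C}$. In particular, the following functions ($1\le i\le n$, $1\le j\le r_i$) are algebraically independent over $\mathbb{C}$: for $\mathfrak{g}_n=\mathfrak{gl}(n)$, $f_{i,j}(x)=\operatorname{tr}(x_i^{\,j})$; for $\mathfrak{g}_n=\mathfrak{so}(n)$, $f_{i,j}(x)=\operatorname{tr}(x_i^{\,2j})$, except that $f_{i,l}(x)=\operatorname{Pfaff}(x_i)$, the Pfaffian, when $i=2l$ and $j=l$. -/

import Mathlib

namespace GelfandZeitlin

/-- `P(V)`: the algebra of polynomial functions on a complex vector space `V`, i.e. the algebra of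
functions generated over `ℂ` by the linear functionals. -/
def polynomialFunctions (V : Type) [AddCommGroup V] [Module ℂ V] : Subalgebra ℂ (V → ℂ) :=
  Algebra.adjoin ℂ (Set.range fun (φ : Module.Dual ℂ V) (v : V) => φ v)

/-- The subalgebra of the functions in `P(V)` that are fixed by every self-map in the set `A`. -/
def invariantPolynomials (V : Type) [AddCommGroup V] [Module ℂ V] (A : Set (V → V)) :
    Subalgebra ℂ (V → ℂ) where
  carrier := {f | f ∈ polynomialFunctions V ∧ ∀ a ∈ A, ∀ x, f (a x) = f x}
  mul_mem' := fun hf hg =>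
    ⟨mul_mem hf.1 hg.1, fun a ha x => by simp [hf.2 a ha x, hg.2 a ha x]⟩
  add_mem' := fun hf hg =>
    ⟨add_mem hf.1 hg.1, fun a ha x => by simp [hf.2 a ha x, hg.2 a ha x]⟩
  algebraMap_mem' := fun c => ⟨Subalgebra.algebraMap_mem _ c, fun _ _ _ => rfl⟩

/-- `𝔤𝔩(n)`: the complex `n × n` matrices. -/
abbrev gl (n : ℕ) : Type := Matrix (Fin n) (Fin n) ℂ

/-- `𝔰𝔬(n)`: the complex skew-symmetric `n × n` matrices (`Aᵀ = -A`). -/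
abbrev so (n : ℕ) : Type := LieAlgebra.Orthogonal.so (Fin n) ℂ

/-- The transformations `Ad(g) : x ↦ g x g⁻¹` of `𝔤𝔩(n)`, `g ∈ GL(n, ℂ)`. -/
def glAdjointGroup (n : ℕ) : Set (gl n → gl n) :=
  Set.range fun (g : GL (Fin n) ℂ) (x : gl n) => (g : gl n) * x * ((g⁻¹ : GL (Fin n) ℂ) : gl n)

/-- The map `x ↦ g x gᵀ` of `𝔰𝔬(n)`. It is `Ad(g)` when `g` is orthogonal, as then `gᵀ = g⁻¹`. -/
def soConj {n : ℕ} (g : gl n) (x : so n) : so n :=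
  ⟨g * (x : gl n) * g.transpose, by
    have hx := (LieAlgebra.Orthogonal.mem_so (Fin n) ℂ (x : gl n)).1 x.2
    rw [LieAlgebra.Orthogonal.mem_so]
    simp [Matrix.transpose_mul, hx, Matrix.mul_assoc]⟩

/-- The transformations `Ad(g)` of `𝔰𝔬(n)`, `g ∈ SO(n, ℂ) = {g | g gᵀ = 1, det g = 1}`. -/
def soAdjointGroup (n : ℕ) : Set (so n → so n) :=
  {a | ∃ g : gl n, g * g.transpose = 1 ∧ g.det = 1 ∧ a = soConj g}

/-- `P(𝔤𝔩(n))^{GL(n)}`. -/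
def glInvariants (n : ℕ) : Subalgebra ℂ (gl n → ℂ) :=
  invariantPolynomials (gl n) (glAdjointGroup n)

/-- `P(𝔰𝔬(n))^{SO(n)}`. -/
def soInvariants (n : ℕ) : Subalgebra ℂ (so n → ℂ) :=
  invariantPolynomials (so n) (soAdjointGroup n)

/-- The rank of `𝔤𝔩(n)`. -/
def glRank (n : ℕ) : ℕ := n

/-- The rank of `𝔰𝔬(n)`: it is `l` for `n = 2l` and for `n = 2l + 1`. -/
def soRank (n : ℕ) : ℕ := n / 2

/-- The cutoff `x ↦ xᵢ` from `𝔤𝔩(n)` to `𝔤𝔩(i)`: the top left hand `i × i` corner. -/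
def glCutoff {i n : ℕ} (h : i ≤ n) (x : gl n) : gl i :=
  x.submatrix (Fin.castLE h) (Fin.castLE h)

/-- The cutoff `x ↦ xᵢ` from `𝔰𝔬(n)` to `𝔰𝔬(i)`: the top left hand `i × i` corner. -/
def soCutoff {i n : ℕ} (h : i ≤ n) (x : so n) : so i :=
  ⟨glCutoff h (x : gl n), by
    have hx := (LieAlgebra.Orthogonal.mem_so (Fin n) ℂ (x : gl n)).1 x.2
    rw [LieAlgebra.Orthogonal.mem_so, glCutoff, Matrix.transpose_submatrix, hx]
    rfl⟩

/-- The Pfaffian of a skew-symmetric `2l × 2l` matrix,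
`(1 / (2 ^ l * l!)) * ∑ σ, sign σ * ∏_{k < l} x (σ (2k)) (σ (2k + 1))` with rows and columns
numbered from `0`; here `l = n / 2`, and only even `n` matter. -/
noncomputable def pfaffian {n : ℕ} (x : gl n) : ℂ :=
  (2 ^ (n / 2) * (Nat.factorial (n / 2) : ℂ))⁻¹ *
    ∑ σ : Equiv.Perm (Fin n), ((Equiv.Perm.sign σ : ℤ) : ℂ) *
      ∏ k : Fin (n / 2),
        x (σ ⟨2 * (k : ℕ), by omega⟩) (σ ⟨2 * (k : ℕ) + 1, by omega⟩)

/-- The standard invariants of `𝔤𝔩(i)`: `tr (x ^ j)` for `1 ≤ j ≤ i`. The index `j : Fin i` starts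
at `0`, so it stands for `j + 1`. -/
def glGenerator (i : ℕ) (j : Fin (glRank i)) (x : gl i) : ℂ :=
  Matrix.trace (x ^ ((j : ℕ) + 1))

/-- The standard invariants of `𝔰𝔬(i)`. If `i = 2l + 1`: `tr (x ^ (2j))` for `1 ≤ j ≤ l`. If
`i = 2l`: `tr (x ^ (2j))` for `1 ≤ j ≤ l - 1`, and the Pfaffian for `j = l`. The index
`j : Fin l` starts at `0`, so it stands for `j + 1`. -/
noncomputable def soGenerator (i : ℕ) (j : Fin (soRank i)) (x : so i) : ℂ :=
  if Even i ∧ (j : ℕ) + 1 = soRank i then pfaffian (x : gl i)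
  else Matrix.trace ((x : gl i) ^ (2 * ((j : ℕ) + 1)))

/-- A family `f i j` of functions on `𝔤𝔩(i)`, `1 ≤ i ≤ n`, `1 ≤ j ≤ rank 𝔤𝔩(i)`, regarded as a
family of functions `x ↦ f i j xᵢ` on `𝔤𝔩(n)`. -/
def glFamily {n : ℕ} (f : (i : Set.Icc 1 n) → Fin (glRank i) → gl i → ℂ)
    (p : Σ i : Set.Icc 1 n, Fin (glRank i)) : gl n → ℂ :=
  fun x => f p.1 p.2 (glCutoff p.1.2.2 x)

/-- A family `f i j` of functions on `𝔰𝔬(i)`, `1 ≤ i ≤ n`, `1 ≤ j ≤ rank 𝔰𝔬(i)`, regarded as a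
family of functions `x ↦ f i j xᵢ` on `𝔰𝔬(n)`. -/
def soFamily {n : ℕ} (f : (i : Set.Icc 1 n) → Fin (soRank i) → so i → ℂ)
    (p : Σ i : Set.Icc 1 n, Fin (soRank i)) : so n → ℂ :=
  fun x => f p.1 p.2 (soCutoff p.1.2.2 x)

end GelfandZeitlin

namespace GelfandZeitlin

/-! If the differentials of the `f p` are linearly independent at one point, their joint map is open
there, so a polynomial vanishing on its values is zero. By the chain rule it is enough that equally
many polynomials `b p` in the `f p` have an invertible Jacobian. For arbitrary generators the `b p`
are traces of powers, which are invariant; that traces generate the invariants is never used.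

The point is the skew tridiagonal matrix `T`, whose corners are again tridiagonal. The direction
attached to `(i, j)` changes an entry in the last column of the `i`-th corner (with its mirror image
for `so`), so smaller corners do not see it. For equal `i`, the derivative of `tr (x ^ (m + 1))`
reads off an entry of `T ^ m`, which vanishes beyond the `m`-th off-diagonals and is `±1` on them.
In lexicographic order the Jacobian is triangular with nonzero diagonal.

The Pfaffian enters only for the standard family. Its derivative at `T` along the extreme corner is
a sum over perfect matchings of a cycle that use one given edge. Only one exists, and all its terms
agree, so nothing cancels. -/

/-! ### Jacobian criterion -/

/-- Polynomial functions are smooth in the coordinates of an affine parametrization. -/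
theorem contDiff_polynomialFunctions_comp_affine {ι V : Type} [Fintype ι] [AddCommGroup V]
    [Module ℂ V] {f : V → ℂ} (hf : f ∈ polynomialFunctions V) (x₀ : V) (y : ι → V) :
    ContDiff ℂ 1 fun u : ι → ℂ => f (x₀ + ∑ q, u q • y q) := by
  induction hf using Algebra.adjoin_induction with
  | mem g hg =>
    obtain ⟨φ, rfl⟩ := hg
    simp only [map_add, map_sum, map_smul, smul_eq_mul]
    fun_prop
  | algebraMap c => exact contDiff_const
  | add g h _ _ hg hh => exact hg.add hh
  | mul g h _ _ hg hh => exact hg.mul hh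

theorem contDiff_mvPolynomial_eval {ι : Type} [Fintype ι] (P : MvPolynomial ι ℂ) :
    ContDiff ℂ 1 fun w : ι → ℂ => MvPolynomial.eval w P := by
  induction P using MvPolynomial.induction_on with
  | C a => simpa using contDiff_const
  | add p q hp hq => simpa using hp.add hq
  | mul_X p i hp => simpa using hp.mul (contDiff_apply ℂ ℂ i)

/-- A polynomial that vanishes near a point of `ℂ ^ ι` is zero. -/
theorem mvPolynomial_eq_zero_of_eventually {ι : Type} [Fintype ι] {P : MvPolynomial ι ℂ}
    {w : ι → ℂ} (h : ∀ᶠ v in nhds w, MvPolynomial.eval v P = 0) : P = 0 := by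
  obtain ⟨ε, hε, hball⟩ := Metric.eventually_nhds_iff_ball.1 h
  -- In the sup metric a ball is a product of discs, which are infinite sets.
  refine MvPolynomial.funext_set (fun i => Metric.ball (w i) ε) (fun i => ?_) fun v hv => ?_
  · exact infinite_of_mem_nhds (w i) (Metric.ball_mem_nhds _ hε)
  · rw [map_zero]
    refine hball v ?_
    rwa [ball_pi _ hε]

/-- Jacobian criterion: polynomial functions `f p` are algebraically independent if as many
polynomials `b p` in them have a nonsingular triangular Jacobian matrix at some point. -/
theorem algebraicIndependent_of_triangular_jacobian {ι V α : Type} [Finite ι] [LinearOrder α]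
    [AddCommGroup V] [Module ℂ V] (key : ι → α) (hkey : Function.Injective key)
    (f b : ι → V → ℂ) (hf : ∀ p, f p ∈ polynomialFunctions V)
    (hb : ∀ p, b p ∈ Algebra.adjoin ℂ (Set.range f)) (x₀ : V) (y : ι → V)
    (hlt : ∀ p q, key p < key q → HasDerivAt (fun t : ℂ => b p (x₀ + t • y q)) 0 0)
    (hdiag : ∀ p, ∃ d ≠ 0, HasDerivAt (fun t : ℂ => b p (x₀ + t • y p)) d 0) :
    AlgebraicIndependent ℂ f := by
  let _ : LinearOrder ι := LinearOrder.lift' key hkey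
  have := Fintype.ofFinite ι
  have hlt' : ∀ p q : ι, p < q → HasDerivAt (fun t : ℂ => b p (x₀ + t • y q)) 0 0 :=
    fun p q h => hlt p q h
  have hb' : ∀ p, ∃ B : MvPolynomial ι ℂ, MvPolynomial.aeval f B = b p := fun p => by
    have := hb p
    rwa [Algebra.adjoin_range_eq_range_aeval] at this
  choose B hB using hb'
  have aeval_apply : ∀ (P : MvPolynomial ι ℂ) (x : V),
      MvPolynomial.aeval f P x = MvPolynomial.eval (fun p => f p x) P := fun P x => by
    induction P using MvPolynomial.induction_on with
    | C a => simp
    | add p q hp hq => simp [hp, hq]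
    | mul_X p i hp => simp [hp]
  let line : (ι → ℂ) → V := fun u => x₀ + ∑ q, u q • y q
  let G : (ι → ℂ) → ι → ℂ := fun u p => f p (line u)
  -- On the affine slice `line`, the family `b` is `D ∘ G`.
  let D : (ι → ℂ) → ι → ℂ := fun w p => MvPolynomial.eval w (B p)
  have hG : ContDiff ℂ 1 G :=
    contDiff_pi.2 fun p => contDiff_polynomialFunctions_comp_affine (hf p) x₀ y
  have hD : ContDiff ℂ 1 D := contDiff_pi.2 fun p => contDiff_mvPolynomial_eval (B p)
  obtain ⟨G', hG'⟩ : ∃ G', HasStrictFDerivAt G G' 0 :=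
    ⟨_, hG.contDiffAt.hasStrictFDerivAt one_ne_zero⟩
  obtain ⟨D', hD'⟩ : ∃ D', HasFDerivAt D D' (G 0) :=
    ⟨_, (hD.differentiable one_ne_zero _).hasFDerivAt⟩
  have hDG : HasFDerivAt (D ∘ G) (D'.comp G') 0 := hD'.comp 0 hG'.hasFDerivAt
  have hpart : ∀ p q, HasDerivAt (fun t : ℂ => b p (x₀ + t • y q))
      ((D'.comp G') (Pi.single q 1) p) 0 := fun p q => by
    have hs : HasDerivAt (fun t : ℂ => t • (Pi.single q 1 : ι → ℂ)) (Pi.single q 1) 0 := by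
      simpa using (hasDerivAt_id (0 : ℂ)).smul_const (Pi.single q 1 : ι → ℂ)
    have h0 : HasFDerivAt (D ∘ G) (D'.comp G') ((0 : ℂ) • (Pi.single q 1 : ι → ℂ)) := by
      rwa [zero_smul]
    have := hasDerivAt_pi.1 (h0.comp_hasDerivAt 0 hs) p
    refine this.congr_of_eventuallyEq (Filter.Eventually.of_forall fun t => ?_)
    simp only [Function.comp, D, G, line]
    rw [← hB p, aeval_apply]
    simp [Pi.single_apply, ite_smul]
  let M : Matrix ι ι ℂ := LinearMap.toMatrix' (D'.comp G' : (ι → ℂ) →ₗ[ℂ] ι → ℂ)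
  have hM : ∀ p q, M p q = (D'.comp G') (Pi.single q 1) p := fun p q => by
    simp [M, LinearMap.toMatrix'_apply]
  have hdet : M.det ≠ 0 := by
    rw [Matrix.det_of_isLowerTriangular (M := M)]
    · refine Finset.prod_ne_zero_iff.2 fun p _ => ?_
      obtain ⟨d, hd, hd'⟩ := hdiag p
      rwa [hM, (hpart p p).unique hd']
    · intro p q hpq
      rw [hM]
      exact (hpart p q).unique (hlt' p q hpq)
  -- `M` represents `D' ∘ G'`, so it kills every vector that `G'` kills.
  have hinj : Function.Injective G' := by
    refine (injective_iff_map_eq_zero G').2 fun v hv => ?_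
    refine Matrix.eq_zero_of_mulVec_eq_zero hdet ?_
    rw [← Matrix.toLin'_apply, Matrix.toLin'_toMatrix']
    simp [hv]
  have hsurj : G'.range = ⊤ := by
    have h2 : Function.Surjective (G' : (ι → ℂ) →ₗ[ℂ] ι → ℂ) :=
      LinearMap.injective_iff_surjective.1 hinj
    exact LinearMap.range_eq_top.2 h2
  -- `G` maps neighbourhoods of `0` onto neighbourhoods of `G 0`, so a relation `P` vanishes near `G
  -- 0`.
  have hmap := hG'.map_nhds_eq_of_surj hsurj
  refine (injective_iff_map_eq_zero _).2 fun P hP => ?_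
  refine mvPolynomial_eq_zero_of_eventually (w := G 0) ?_
  rw [← hmap]
  refine Filter.eventually_map.2 (Filter.Eventually.of_forall fun u => ?_)
  have := aeval_apply P (line u)
  rw [hP] at this
  exact this.symm

/-! ### The base point and the entries of its powers -/

/-- The tridiagonal skew-symmetric matrix with `1` above and `-1` below the diagonal. -/
def tridiagonal (n : ℕ) : gl n :=
  Matrix.of fun r c => if (c : ℕ) = r + 1 then 1 else if (r : ℕ) = c + 1 then -1 else 0

/-- The matrix unit at position `(a, b)`; it is zero unless `a, b < n`. -/
def matrixUnit (n a b : ℕ) : gl n :=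
  Matrix.of fun r c => if (r : ℕ) = a ∧ (c : ℕ) = b then 1 else 0

theorem transpose_tridiagonal (n : ℕ) : (tridiagonal n).transpose = -tridiagonal n := by
  ext r c
  simp only [tridiagonal, Matrix.transpose_apply, Matrix.of_apply, Matrix.neg_apply]
  split_ifs <;> first | omega | simp

theorem transpose_matrixUnit (n a b : ℕ) : (matrixUnit n a b).transpose = matrixUnit n b a := by
  ext r c
  simp [matrixUnit, and_comm]

theorem matrixUnit_eq_single {n : ℕ} (a b : Fin n) :
    matrixUnit n a b = Matrix.single a b 1 := by
  ext r c
  simp [matrixUnit, Matrix.single_apply, Fin.ext_iff, eq_comm]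

/-- With natural-number positions one expression describes a direction and all its cutoffs; a cutoff
that misses the position is zero. -/
theorem matrixUnit_eq_zero_right {n a b : ℕ} (h : n ≤ b) : matrixUnit n a b = 0 := by
  ext r c
  simp only [matrixUnit, Matrix.of_apply, Matrix.zero_apply, ite_eq_right_iff]
  omega

theorem matrixUnit_eq_zero_left {n a b : ℕ} (h : n ≤ a) : matrixUnit n a b = 0 := by
  ext r c
  simp only [matrixUnit, Matrix.of_apply, Matrix.zero_apply, ite_eq_right_iff]
  omega

/-- Entry `(r, c)` of the `m`-th power is a signed count of walks of length `m` from `r` to `c` on a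
path. There are none if `c - r > m`; if `c - r = m` there is one, with all weights `1`. -/
theorem tridiagonal_pow_apply_eq_zero {n m : ℕ} {r c : Fin n} (h : (r : ℕ) + m < c) :
    (tridiagonal n ^ m) r c = 0 := by
  induction m generalizing r with
  | zero => rw [pow_zero, Matrix.one_apply_ne]; rintro rfl; omega
  | succ m ih =>
    rw [pow_succ', Matrix.mul_apply]
    refine Finset.sum_eq_zero fun k _ => ?_
    by_cases hk : (k : ℕ) ≤ r + 1
    · rw [ih (by omega), mul_zero]
    · rw [tridiagonal, Matrix.of_apply, if_neg (by omega), if_neg (by omega), zero_mul]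

theorem tridiagonal_pow_apply_eq_one {n m : ℕ} {r c : Fin n} (h : (r : ℕ) + m = c) :
    (tridiagonal n ^ m) r c = 1 := by
  induction m generalizing r with
  | zero =>
    obtain rfl : r = c := Fin.ext (by omega)
    rw [pow_zero, Matrix.one_apply_eq]
  | succ m ih =>
    rw [pow_succ', Matrix.mul_apply, Finset.sum_eq_single ⟨r + 1, by omega⟩]
    · rw [ih (by simp only; omega)]
      simp [tridiagonal]
    · intro k _ hk
      rw [Ne, Fin.ext_iff] at hk
      by_cases hk : (k : ℕ) ≤ r
      · rw [tridiagonal_pow_apply_eq_zero (by omega), mul_zero]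
      · rw [tridiagonal, Matrix.of_apply, if_neg (by simp_all), if_neg (by omega), zero_mul]
    · simp

theorem tridiagonal_pow_apply_comm {n : ℕ} (m : ℕ) (r c : Fin n) :
    (tridiagonal n ^ m) c r = (-1) ^ m * (tridiagonal n ^ m) r c := by
  rw [← Matrix.transpose_apply (tridiagonal n ^ m), Matrix.transpose_pow, transpose_tridiagonal]
  obtain hm | hm := m.even_or_odd
  · rw [hm.neg_pow, hm.neg_one_pow, one_mul]
  · rw [hm.neg_pow, hm.neg_one_pow, Matrix.neg_apply, neg_one_mul]

/-! ### Derivatives of traces of powers -/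

/-- A derivative of `x ^ (m + 1)` in the direction `y`, and its traces against powers of `x`. -/
theorem exists_hasDerivAt_pow {n : ℕ} (m : ℕ) (x y : gl n) :
    ∃ D : gl n, (∀ r c, HasDerivAt (fun t : ℂ => ((x + t • y) ^ (m + 1)) r c) (D r c) 0) ∧
      ∀ k, (D * x ^ k).trace = (m + 1) * (x ^ (m + k) * y).trace := by
  have h1 : ∀ r c, HasDerivAt (fun t : ℂ => (x + t • y) r c) (y r c) 0 := fun r c => by
    simpa using! ((hasDerivAt_id (0 : ℂ)).mul_const (y r c)).const_add (x r c)
  induction m with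
  | zero => exact ⟨y, by simpa using h1, fun k => by
      simp [Matrix.trace_mul_comm y]⟩
  | succ m ih =>
    obtain ⟨D, hD, htr⟩ := ih
    -- Product rule. The trace identity is needed for all `k`, as the induction uses it at `k + 1`.
    refine ⟨D * x + x ^ (m + 1) * y, fun r c => ?_, fun k => ?_⟩
    · have h2 := HasDerivAt.fun_sum (u := Finset.univ) fun k _ => (hD r k).mul (h1 k c)
      simp only [zero_smul, add_zero, Finset.sum_add_distrib] at h2
      have h3 : (fun t : ℂ => ((x + t • y) ^ (m + 1 + 1)) r c) = fun t : ℂ =>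
          ∑ k, ((x + t • y) ^ (m + 1)) r k * (x + t • y) k c := by
        funext t
        rw [pow_succ, Matrix.mul_apply]
      rw [h3]
      simpa only [Matrix.add_apply, Matrix.mul_apply] using! h2
    · rw [add_mul, Matrix.trace_add, mul_assoc, ← pow_succ', htr,
        Matrix.trace_mul_comm (x ^ (m + 1) * y), ← mul_assoc, ← pow_add]
      rw [show m + (k + 1) = m + 1 + k by ring, add_comm k]
      push_cast
      ring

/-- The derivative of `tr (x ^ (m + 1))` in the direction `y` is `(m + 1) tr (x ^ m y)`. -/
theorem hasDerivAt_trace_pow {n : ℕ} (m : ℕ) (x y : gl n) :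
    HasDerivAt (fun t : ℂ => ((x + t • y) ^ (m + 1)).trace) ((m + 1) * (x ^ m * y).trace) 0 := by
  obtain ⟨D, hD, htr⟩ := exists_hasDerivAt_pow m x y
  have h := HasDerivAt.fun_sum (u := Finset.univ) fun k _ => hD k k
  have htr0 := htr 0
  rw [pow_zero, mul_one, add_zero] at htr0
  rw [← htr0]
  exact h

theorem trace_mul_matrixUnit {n : ℕ} (x : gl n) (a b : Fin n) :
    (x * matrixUnit n a b).trace = x b a := by
  rw [matrixUnit_eq_single, Matrix.trace_mul_single]
  simp

/-! ### Derivative of the Pfaffian -/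

/-- A permutation that preserves the blocks `{(k, 0), (k, 1)}` changes the product of the entries
of a skew-symmetric matrix over the blocks by its sign. -/
theorem sign_mul_prod_of_block_preserving {ι : Type} [Fintype ι] [DecidableEq ι]
    (τ : Equiv.Perm (ι × Fin 2)) (hτ : ∀ k, (τ (k, 0)).1 = (τ (k, 1)).1)
    (z : ι × Fin 2 → ι × Fin 2 → ℂ) (hz : ∀ a b, z b a = -z a b) :
    ((Equiv.Perm.sign τ : ℤ) : ℂ) * ∏ k, z (τ (k, 0)) (τ (k, 1)) = ∏ k, z (k, 0) (k, 1) := by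
  have hfst : ∀ k j, (τ (k, j)).1 = (τ (k, 0)).1 := fun k j => by
    fin_cases j
    · rfl
    · exact (hτ k).symm
  have hsurj : Function.Surjective fun k => (τ (k, 0)).1 := fun k => by
    refine ⟨(τ.symm (k, 0)).1, ?_⟩
    have := hfst (τ.symm (k, 0)).1 (τ.symm (k, 0)).2
    simp only [Prod.mk.eta, Equiv.apply_symm_apply] at this
    exact this.symm
  let π : Equiv.Perm ι := Equiv.ofBijective _ (Finite.surjective_iff_bijective.1 hsurj)
  have hπ : ∀ k j, (τ (k, j)).1 = π k := hfst
  let ε : ι → Equiv.Perm (Fin 2) := fun k =>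
    Equiv.ofBijective (fun j => (τ (k, j)).2) (Finite.injective_iff_bijective.1 fun a b hab => by
      have : τ (k, a) = τ (k, b) := Prod.ext ((hπ k a).trans (hπ k b).symm) hab
      simpa using this)
  have hτε : ∀ k j, τ (k, j) = (π k, ε k j) := fun k j => Prod.ext (hπ k j) rfl
  have hdecomp : τ = Equiv.prodCongrLeft (fun _ => π) * Equiv.prodCongrRight ε := by
    refine Equiv.ext fun ⟨k, j⟩ => ?_
    rw [hτε]
    rfl
  -- The block permutation acts as `π` on both layers, so its sign is a square; only the flips `ε k`
  -- contribute.
  have hsign : Equiv.Perm.sign τ = ∏ k, Equiv.Perm.sign (ε k) := by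
    rw [hdecomp, Equiv.Perm.sign_mul, Equiv.Perm.sign_prodCongrLeft,
      Equiv.Perm.sign_prodCongrRight]
    simp
  have hswap : ∀ (e : Equiv.Perm (Fin 2)) (k : ι),
      ((Equiv.Perm.sign e : ℤ) : ℂ) * z (k, e 0) (k, e 1) = z (k, 0) (k, 1) := fun e k => by
    obtain rfl | rfl : e = 1 ∨ e = Equiv.swap 0 1 := by
      revert e
      decide
    · simp
    · simp [hz (k, 0) (k, 1)]
  rw [hsign]
  push_cast
  rw [← Finset.prod_mul_distrib, ← Equiv.prod_comp π fun k => z (k, 0) (k, 1)]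
  refine Finset.prod_congr rfl fun k _ => ?_
  rw [hτε, hτε]
  exact hswap (ε k) (π k)

/-- The only perfect matching of the cycle `0 - 1 - ⋯ - (n - 1) - 0` that contains the edge
`{n - 1, 0}` consists of this edge and of the edges `{m, m + 1}`, `m` odd. -/
theorem odd_of_cycle_matching {ι : Type} {n : ℕ} (A B : ι → ℕ) (k₀ : ι)
    (hk₀ : A k₀ = 0 ∧ B k₀ = n - 1 ∨ A k₀ = n - 1 ∧ B k₀ = 0)
    (hadj : ∀ k ≠ k₀, B k = A k + 1 ∨ A k = B k + 1)
    (hlt : ∀ k, A k < n ∧ B k < n)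
    (hcover : ∀ m < n, ∃ k, A k = m ∨ B k = m)
    (hA : ∀ k k', A k = A k' → k = k') (hB : ∀ k k', B k = B k' → k = k')
    (hAB : ∀ k k', A k ≠ B k') :
    ∀ m, ∀ k ≠ k₀, A k = m ∧ B k = m + 1 ∨ B k = m ∧ A k = m + 1 → Odd m := by
  intro m
  induction m using Nat.strong_induction_on with
  | _ m ih =>
    intro k hk hm
    by_contra hodd
    rw [Nat.not_odd_iff_even] at hodd
    have hm0 : m ≠ 0 := by
      rintro rfl
      have h1 := hA k k₀
      have h2 := hB k k₀
      have h3 := hAB k k₀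
      have h4 := hAB k₀ k
      grind
    -- The edge at `m - 1` is neither `k₀` nor `k`, so it is `{m - 2, m - 1}`, with `m - 2` even.
    obtain ⟨k', hk'⟩ := hcover (m - 1) (by have := hlt k; omega)
    have hne : k' ≠ k₀ := by
      rintro rfl
      have := hlt k
      have : m ≠ 1 := by rintro rfl; simp at hodd
      omega
    have hne' : k' ≠ k := by
      rintro rfl
      omega
    have h1 := hA k k'
    have h2 := hB k k'
    have h3 := hAB k k'
    have h4 := hAB k' k
    have h5 := hadj k' hne
    have h6 : m - 2 < m := by omega
    have h7 : m - 2 + 1 = m - 1 := by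
      have : m ≠ 1 := by rintro rfl; simp at hodd
      omega
    have h8 : ¬ Odd (m - 2) := by
      rw [Nat.not_odd_iff_even]
      exact (Nat.even_sub (by omega)).2 (by simp [hodd])
    refine h8 (ih (m - 2) h6 k' hne ?_)
    rcases hk' with hk' | hk' <;> rcases h5 with h5 | h5 <;> grind

/-- The equivalence `(k, j) ↦ 2 k + j`, for even `n`. -/
def pairEquiv {n : ℕ} (hn : Even n) : Fin (n / 2) × Fin 2 ≃ Fin n :=
  finProdFinEquiv.trans (finCongr (Nat.div_mul_cancel hn.two_dvd))

theorem pairEquiv_val {n : ℕ} (hn : Even n) (x : Fin (n / 2) × Fin 2) :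
    (pairEquiv hn x : ℕ) = x.2 + 2 * x.1 := rfl

/-- The cyclic permutation `m ↦ m - 1` of `Fin n`. -/
def cyclicPred {n : ℕ} (hn : 0 < n) : Equiv.Perm (Fin n) where
  toFun m := if (m : ℕ) = 0 then ⟨n - 1, by omega⟩ else ⟨m - 1, by omega⟩
  invFun m := if h : (m : ℕ) = n - 1 then ⟨0, hn⟩ else ⟨m + 1, by omega⟩
  left_inv m := by
    apply Fin.ext
    by_cases h : (m : ℕ) = 0
    · simp [h]
    · simp only [if_neg h]
      rw [dif_neg (by omega)]
      simp only
      omega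
  right_inv m := by
    apply Fin.ext
    by_cases h : (m : ℕ) = n - 1
    · simp [h]
    · simp [h]

theorem cyclicPred_val {n : ℕ} (hn : 0 < n) (m : Fin n) :
    (cyclicPred hn m : ℕ) = if (m : ℕ) = 0 then n - 1 else m - 1 := by
  simp only [cyclicPred, Equiv.coe_fn_mk]
  split_ifs <;> rfl

theorem cyclicPred_symm_val {n : ℕ} (hn : 0 < n) (m : Fin n) :
    ((cyclicPred hn).symm m : ℕ) = if (m : ℕ) = n - 1 then 0 else (m : ℕ) + 1 := by
  simp only [cyclicPred, Equiv.coe_fn_symm_mk]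
  split_ifs <;> rfl

/-- The terms of the derivative of the Pfaffian at `tridiagonal n` in the direction of the corner
entries all vanish or have a common value. -/
theorem pfaffian_derivative_term {n : ℕ} (hn : Even n) (hpos : 0 < n) :
    ∃ c : ℂ, ∀ (σ : Equiv.Perm (Fin n)) (k₀ : Fin (n / 2)),
      ((Equiv.Perm.sign σ : ℤ) : ℂ) *
        ((∏ k ∈ Finset.univ.erase k₀, tridiagonal n (σ (pairEquiv hn (k, 0)))
          (σ (pairEquiv hn (k, 1)))) *
        (matrixUnit n 0 (n - 1) - matrixUnit n (n - 1) 0) (σ (pairEquiv hn (k₀, 0)))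
          (σ (pairEquiv hn (k₀, 1)))) ≠ 0 →
      ((Equiv.Perm.sign σ : ℤ) : ℂ) *
        ((∏ k ∈ Finset.univ.erase k₀, tridiagonal n (σ (pairEquiv hn (k, 0)))
          (σ (pairEquiv hn (k, 1)))) *
        (matrixUnit n 0 (n - 1) - matrixUnit n (n - 1) 0) (σ (pairEquiv hn (k₀, 0)))
          (σ (pairEquiv hn (k₀, 1)))) = c := by
  set e := pairEquiv hn with he
  set y : gl n := matrixUnit n 0 (n - 1) - matrixUnit n (n - 1) 0 with hy
  set s := cyclicPred hpos with hs
  let corner : Fin n → Fin n → Prop := fun a b =>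
    (a : ℕ) = 0 ∧ (b : ℕ) = n - 1 ∨ (a : ℕ) = n - 1 ∧ (b : ℕ) = 0
  classical
  let W : Fin n → Fin n → ℂ := fun a b => if corner a b then y a b else tridiagonal n a b
  have hcorner : ∀ a b, corner b a ↔ corner a b := fun a b => by
    simp only [corner]
    tauto
  have hWskew : ∀ a b, W b a = -W a b := fun a b => by
    simp only [W, hcorner a b]
    split_ifs
    · rw [hy]
      simp only [Matrix.sub_apply, neg_sub]
      rw [← transpose_matrixUnit n 0 (n - 1)]
      simp [Matrix.transpose_apply]
    · rw [← Matrix.transpose_apply (tridiagonal n), transpose_tridiagonal, Matrix.neg_apply]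
  -- `s` realizes the matching `{n - 1, 0}, {1, 2}, {3, 4}, …`.
  refine ⟨((Equiv.Perm.sign s : ℤ) : ℂ) * ∏ k, W (s (e (k, 0))) (s (e (k, 1))), ?_⟩
  intro σ k₀ hne
  obtain ⟨-, hne⟩ := mul_ne_zero_iff.1 hne
  obtain ⟨hT, hY⟩ := mul_ne_zero_iff.1 hne
  rw [Finset.prod_ne_zero_iff] at hT
  have hk₀ : corner (σ (e (k₀, 0))) (σ (e (k₀, 1))) := by
    by_contra h
    simp only [corner, not_or] at h
    refine hY ?_
    simp only [hy, Matrix.sub_apply, matrixUnit, Matrix.of_apply]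
    rw [if_neg h.1, if_neg h.2, sub_zero]
  have hadj : ∀ k ≠ k₀, (σ (e (k, 1)) : ℕ) = σ (e (k, 0)) + 1 ∨
      (σ (e (k, 0)) : ℕ) = σ (e (k, 1)) + 1 := fun k hk => by
    by_contra! h
    refine hT k (by simp [hk]) ?_
    rw [tridiagonal, Matrix.of_apply, if_neg h.1, if_neg h.2]
  have hval : ∀ k k' j j', (σ (e (k, j)) : ℕ) = σ (e (k', j')) → k = k' ∧ j = j' := by
    intro k k' j j' h
    simpa using e.injective (σ.injective (Fin.ext h))
  have hodd := odd_of_cycle_matching (fun k => (σ (e (k, 0)) : ℕ)) (fun k => (σ (e (k, 1)) : ℕ))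
    k₀ hk₀ hadj (fun k => ⟨Fin.is_lt _, Fin.is_lt _⟩)
    (fun m hm => by
      obtain ⟨⟨k, j⟩, hkj⟩ := (e.trans σ).surjective ⟨m, hm⟩
      refine ⟨k, ?_⟩
      have hkj' : (σ (e (k, j)) : ℕ) = m := congrArg Fin.val hkj
      fin_cases j
      · exact Or.inl hkj'
      · exact Or.inr hkj')
    (fun k k' h => (hval _ _ _ _ h).1) (fun k k' h => (hval _ _ _ _ h).1)
    (fun k k' h => by simpa using (hval _ _ _ _ h).2)
  have hnot : ∀ k ≠ k₀, ¬ corner (σ (e (k, 0))) (σ (e (k, 1))) := fun k hk h => by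
    have h1 : (σ (e (k, 0)) : ℕ) = σ (e (k₀, 0)) ∨ (σ (e (k, 0)) : ℕ) = σ (e (k₀, 1)) := by
      simp only [corner] at h hk₀
      omega
    rcases h1 with h1 | h1 <;> exact hk (hval _ _ _ _ h1).1
  have hprod : (∏ k ∈ Finset.univ.erase k₀, tridiagonal n (σ (e (k, 0))) (σ (e (k, 1)))) *
      y (σ (e (k₀, 0))) (σ (e (k₀, 1))) = ∏ k, W (σ (e (k, 0))) (σ (e (k, 1))) := by
    rw [← Finset.prod_erase_mul _ _ (Finset.mem_univ k₀)]
    congr 1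
    · refine Finset.prod_congr rfl fun k hk => ?_
      exact (if_neg (hnot k (Finset.ne_of_mem_erase hk))).symm
    · exact (if_pos hk₀).symm
  -- `σ` and `s` give the same matching, so `s⁻¹ σ`, read on pairs, preserves blocks.
  let τ : Equiv.Perm (Fin (n / 2) × Fin 2) := (e.trans (σ.trans s.symm)).trans e.symm
  have hτ : ∀ x, s (e (τ x)) = σ (e x) := fun x => by simp [τ]
  have hsign : Equiv.Perm.sign σ = Equiv.Perm.sign s * Equiv.Perm.sign τ := by
    have h1 : Equiv.Perm.sign τ = Equiv.Perm.sign (s⁻¹ * σ) :=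
      Equiv.Perm.sign_trans_trans_symm _ e
    rw [h1, ← Equiv.Perm.sign_mul, mul_inv_cancel_left]
  have hfst : ∀ x, ((τ x).1 : ℕ) = (if (σ (e x) : ℕ) = n - 1 then 0 else (σ (e x) : ℕ) + 1) / 2 := by
    intro x
    rw [← cyclicPred_symm_val hpos, ← hs, ← hτ, Equiv.symm_apply_apply, he, pairEquiv_val]
    omega
  -- The cyclic shift by one sends `{m, m + 1}`, `m` odd, to `{m + 1, m + 2}`, and `{n - 1, 0}` to
  -- `{0, 1}`; both ends then have the same half.
  have hblock : ∀ k, (τ (k, 0)).1 = (τ (k, 1)).1 := fun k => by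
    apply Fin.ext
    rw [hfst, hfst]
    have := hn.two_dvd
    by_cases hk : k = k₀
    · subst hk
      simp only [corner] at hk₀
      split_ifs <;> omega
    · have h1 := (σ (e (k, 0))).is_lt
      have h2 := (σ (e (k, 1))).is_lt
      rcases hadj k hk with h | h
      · obtain ⟨m, hm⟩ := hodd _ k hk (Or.inl ⟨rfl, h⟩)
        split_ifs <;> omega
      · obtain ⟨m, hm⟩ := hodd _ k hk (Or.inr ⟨rfl, h⟩)
        split_ifs <;> omega
  have hL := sign_mul_prod_of_block_preserving τ hblock (fun a b => W (s (e a)) (s (e b)))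
    fun a b => hWskew _ _
  simp only [hτ] at hL
  rw [hprod, hsign, ← hL]
  push_cast
  ring

/-- At `tridiagonal n` the Pfaffian has nonzero derivative in the direction of the corner
entries. -/
theorem exists_hasDerivAt_pfaffian {n : ℕ} (hn : Even n) (hpos : 0 < n) :
    ∃ d ≠ 0, HasDerivAt (fun t : ℂ => pfaffian (tridiagonal n +
      t • (matrixUnit n 0 (n - 1) - matrixUnit n (n - 1) 0))) d 0 := by
  set y : gl n := matrixUnit n 0 (n - 1) - matrixUnit n (n - 1) 0 with hy
  obtain ⟨c, hc⟩ := pfaffian_derivative_term hn hpos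
  rw [← hy] at hc
  set e := pairEquiv hn with he
  let term : Equiv.Perm (Fin n) × Fin (n / 2) → ℂ := fun p =>
    ((Equiv.Perm.sign p.1 : ℤ) : ℂ) *
      ((∏ k ∈ Finset.univ.erase p.2, tridiagonal n (p.1 (e (k, 0))) (p.1 (e (k, 1)))) *
        y (p.1 (e (p.2, 0))) (p.1 (e (p.2, 1))))
  have hterm : ∀ p, term p ≠ 0 → term p = c := fun p => hc p.1 p.2
  have htwo := hn.two_dvd
  have hex : term (cyclicPred hpos, ⟨0, by omega⟩) ≠ 0 := by
    refine mul_ne_zero ?_ (mul_ne_zero (Finset.prod_ne_zero_iff.2 fun k hk => ?_) ?_)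
    · exact_mod_cast (Equiv.Perm.sign (cyclicPred hpos)).ne_zero
    · have hk : (k : ℕ) ≠ 0 := fun h => Finset.ne_of_mem_erase hk (Fin.ext h)
      rw [tridiagonal, Matrix.of_apply, if_pos]
      · exact one_ne_zero
      · rw [cyclicPred_val, cyclicPred_val, he, pairEquiv_val, pairEquiv_val]
        simp only [Fin.val_zero, Fin.val_one]
        split_ifs <;> omega
    · have h0 : (cyclicPred hpos (e (⟨0, by omega⟩, 0)) : ℕ) = n - 1 := by
        rw [cyclicPred_val, he, pairEquiv_val]
        simp
      have h1 : (cyclicPred hpos (e (⟨0, by omega⟩, 1)) : ℕ) = 0 := by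
        rw [cyclicPred_val, he, pairEquiv_val]
        simp
      simp only [hy, Matrix.sub_apply, matrixUnit, Matrix.of_apply, h0, h1]
      rw [if_neg (by omega), if_pos (by simp)]
      simp
  -- The sum is `c ≠ 0` times the positive number of nonzero terms.
  have hsum : ∑ p, term p ≠ 0 := by
    have h1 : ∀ p, term p = if term p ≠ 0 then c else 0 := fun p => by
      split_ifs with h
      · exact hterm p h
      · simpa using h
    rw [Finset.sum_congr rfl fun p _ => h1 p, ← Finset.sum_filter, Finset.sum_const,
      nsmul_eq_mul]
    have hmem : (cyclicPred hpos, (⟨0, by omega⟩ : Fin (n / 2))) ∈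
        Finset.univ.filter fun p => term p ≠ 0 := Finset.mem_filter.2 ⟨Finset.mem_univ _, hex⟩
    refine mul_ne_zero (Nat.cast_ne_zero.2 (Finset.card_ne_zero_of_mem hmem)) ?_
    rw [← hterm _ hex]
    exact hex
  refine ⟨(2 ^ (n / 2) * (Nat.factorial (n / 2) : ℂ))⁻¹ * ∑ p, term p, mul_ne_zero
    (inv_ne_zero (mul_ne_zero (by simp) (by exact_mod_cast Nat.factorial_ne_zero _))) hsum, ?_⟩
  rw [Fintype.sum_prod_type]
  refine HasDerivAt.const_mul _ (HasDerivAt.fun_sum fun σ _ => ?_)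
  simp only [term]
  rw [← Finset.mul_sum]
  refine HasDerivAt.const_mul _ ?_
  have hentry : ∀ a b, HasDerivAt (fun t : ℂ => (tridiagonal n + t • y) a b) (y a b) 0 :=
    fun a b => by
      simpa using! ((hasDerivAt_id (0 : ℂ)).mul_const (y a b)).const_add (tridiagonal n a b)
  have h := HasDerivAt.fun_finsetProd (u := Finset.univ) fun (k : Fin (n / 2)) _ =>
    hentry (σ (e (k, 0))) (σ (e (k, 1)))
  simp only [zero_smul, add_zero, smul_eq_mul] at h
  have he0 : ∀ k : Fin (n / 2), e (k, 0) = ⟨2 * (k : ℕ), by omega⟩ := fun k => by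
    apply Fin.ext
    rw [he, pairEquiv_val]
    simp
  have he1 : ∀ k : Fin (n / 2), e (k, 1) = ⟨2 * (k : ℕ) + 1, by omega⟩ := fun k => by
    apply Fin.ext
    rw [he, pairEquiv_val]
    simp [add_comm]
  simp only [he0, he1] at h ⊢
  exact h

/-! ### Polynomiality and invariance -/

theorem linear_mem_polynomialFunctions {V : Type} [AddCommGroup V] [Module ℂ V]
    (φ : Module.Dual ℂ V) : (fun v => φ v) ∈ polynomialFunctions V :=
  Algebra.subset_adjoin ⟨φ, rfl⟩

/-- Polynomial functions pull back to polynomial functions under linear maps. -/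
theorem comp_linearMap_mem_polynomialFunctions {V W : Type} [AddCommGroup V] [Module ℂ V]
    [AddCommGroup W] [Module ℂ W] {f : W → ℂ} (hf : f ∈ polynomialFunctions W)
    (L : V →ₗ[ℂ] W) : (fun v => f (L v)) ∈ polynomialFunctions V := by
  induction hf using Algebra.adjoin_induction with
  | mem g hg =>
    obtain ⟨φ, rfl⟩ := hg
    exact linear_mem_polynomialFunctions (φ.comp L)
  | algebraMap c => exact Subalgebra.algebraMap_mem _ c
  | add g h _ _ hg hh => exact add_mem hg hh
  | mul g h _ _ hg hh => exact mul_mem hg hh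

theorem entry_mem_polynomialFunctions {n : ℕ} (r c : Fin n) :
    (fun x : gl n => x r c) ∈ polynomialFunctions (gl n) :=
  linear_mem_polynomialFunctions (Matrix.entryLinearMap ℂ ℂ r c)

theorem pow_entry_mem_polynomialFunctions {n : ℕ} (m : ℕ) (r c : Fin n) :
    (fun x : gl n => (x ^ m) r c) ∈ polynomialFunctions (gl n) := by
  induction m generalizing c with
  | zero =>
    simp only [pow_zero]
    exact Subalgebra.algebraMap_mem _ ((1 : gl n) r c)
  | succ m ih =>
    have h : (fun x : gl n => (x ^ (m + 1)) r c) =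
        ∑ k, (fun x : gl n => (x ^ m) r k) * fun x : gl n => x k c := by
      funext x
      simp [pow_succ, Matrix.mul_apply]
    rw [h]
    exact sum_mem fun k _ => mul_mem (ih k) (entry_mem_polynomialFunctions k c)

theorem trace_pow_mem_polynomialFunctions (n m : ℕ) :
    (fun x : gl n => (x ^ m).trace) ∈ polynomialFunctions (gl n) := by
  have h : (fun x : gl n => (x ^ m).trace) = ∑ k, fun x : gl n => (x ^ m) k k := by
    funext x
    simp [Matrix.trace]
  rw [h]
  exact sum_mem fun k _ => pow_entry_mem_polynomialFunctions m k k

theorem pfaffian_mem_polynomialFunctions (n : ℕ) :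
    (fun x : gl n => pfaffian x) ∈ polynomialFunctions (gl n) := by
  have h : (fun x : gl n => pfaffian x) = (2 ^ (n / 2) * (Nat.factorial (n / 2) : ℂ))⁻¹ •
      ∑ σ : Equiv.Perm (Fin n), ((Equiv.Perm.sign σ : ℤ) : ℂ) • ∏ k : Fin (n / 2),
        fun x : gl n => x (σ ⟨2 * (k : ℕ), by omega⟩) (σ ⟨2 * (k : ℕ) + 1, by omega⟩) := by
    funext x
    simp [pfaffian]
  rw [h]
  exact Subalgebra.smul_mem _ (sum_mem fun σ _ => Subalgebra.smul_mem _
    (prod_mem fun k _ => entry_mem_polynomialFunctions _ _) _) _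

/-- The cutoff of `𝔤𝔩(n)` as a linear map. -/
def glCutoffLinear {i n : ℕ} (h : i ≤ n) : gl n →ₗ[ℂ] gl i where
  toFun := glCutoff h
  map_add' _ _ := rfl
  map_smul' _ _ := rfl

/-- The cutoff of `𝔰𝔬(n)` as a linear map. -/
def soCutoffLinear {i n : ℕ} (h : i ≤ n) : so n →ₗ[ℂ] so i where
  toFun := soCutoff h
  map_add' _ _ := rfl
  map_smul' _ _ := rfl

/-- The inclusion of `𝔰𝔬(n)` into `𝔤𝔩(n)` as a linear map. -/
def soInclusion (n : ℕ) : so n →ₗ[ℂ] gl n where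
  toFun x := x
  map_add' _ _ := rfl
  map_smul' _ _ := rfl

theorem glGenerator_mem_glInvariants (i : ℕ) (j : Fin (glRank i)) :
    glGenerator i j ∈ glInvariants i := by
  refine ⟨trace_pow_mem_polynomialFunctions i _, ?_⟩
  rintro _ ⟨g, rfl⟩ x
  simp only [glGenerator]
  have h : ((g : gl i) * x * ((g⁻¹ : GL (Fin i) ℂ) : gl i)) ^ ((j : ℕ) + 1) =
      g * x ^ ((j : ℕ) + 1) * ((g⁻¹ : GL (Fin i) ℂ) : gl i) := Units.conj_pow g x _
  rw [h, Matrix.trace_units_conj]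

theorem soTrace_mem_soInvariants (i m : ℕ) :
    (fun x : so i => ((x : gl i) ^ m).trace) ∈ soInvariants i := by
  refine ⟨comp_linearMap_mem_polynomialFunctions (trace_pow_mem_polynomialFunctions i m)
    (soInclusion i), ?_⟩
  rintro _ ⟨g, hg, -, rfl⟩ x
  have hg' : g.transpose * g = 1 := mul_eq_one_comm.1 hg
  have h := Units.conj_pow (⟨g, g.transpose, hg, hg'⟩ : (gl i)ˣ) (x : gl i) m
  simp only [Units.inv_mk] at h
  simp only [soConj]
  rw [h, Matrix.trace_mul_comm, ← mul_assoc, hg', one_mul]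

/-! ### Triangular Jacobians of the two families -/

/-- Functions on corners that are polynomials in `f i 1, f i 2, …` are polynomials in the family
obtained from `f`. -/
theorem comp_mem_adjoin {ι V W : Type} {κ : Type} {f : κ → W → ℂ} {g : W → ℂ} {F : ι → V → ℂ}
    (L : V → W) (hf : ∀ j, (fun v => f j (L v)) ∈ Set.range F)
    (hg : g ∈ Algebra.adjoin ℂ (Set.range f)) :
    (fun v => g (L v)) ∈ Algebra.adjoin ℂ (Set.range F) := by
  induction hg using Algebra.adjoin_induction with
  | mem g hg =>
    obtain ⟨j, rfl⟩ := hg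
    exact Algebra.subset_adjoin (hf j)
  | algebraMap c => exact Subalgebra.algebraMap_mem _ c
  | add g h _ _ hg hh => exact add_mem hg hh
  | mul g h _ _ hg hh => exact mul_mem hg hh

/-- The lexicographic order on the indices `(i, j)`. -/
def lexKey {n : ℕ} {r : ℕ → ℕ} (p : Σ i : Set.Icc 1 n, Fin (r i)) : ℕ ×ₗ ℕ :=
  toLex ((p.1 : ℕ), (p.2 : ℕ))

theorem lexKey_injective {n : ℕ} {r : ℕ → ℕ} :
    Function.Injective (lexKey : (Σ i : Set.Icc 1 n, Fin (r i)) → ℕ ×ₗ ℕ) := by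
  rintro ⟨⟨i, hi⟩, j⟩ ⟨⟨i', hi'⟩, j'⟩ h
  simp only [lexKey, EmbeddingLike.apply_eq_iff_eq, Prod.mk.injEq] at h
  obtain ⟨rfl, h⟩ := h
  rw [Fin.val_inj] at h
  rw [h]

theorem lexKey_lt {n : ℕ} {r : ℕ → ℕ} {p q : Σ i : Set.Icc 1 n, Fin (r i)}
    (h : lexKey p < lexKey q) :
    (p.1 : ℕ) < q.1 ∨ (p.1 : ℕ) = q.1 ∧ (p.2 : ℕ) < q.2 :=
  Prod.Lex.toLex_lt_toLex.1 h

/-- If every invariant trace function is a polynomial in `f`, then `f` is algebraically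
independent. -/
theorem algebraicIndependent_glFamily {n : ℕ}
    (f : (i : Set.Icc 1 n) → Fin (glRank i) → gl i → ℂ)
    (hf : ∀ (i : Set.Icc 1 n) j, f i j ∈ polynomialFunctions (gl i))
    (hgen : ∀ (i : Set.Icc 1 n) j, glGenerator i j ∈ Algebra.adjoin ℂ (Set.range (f i))) :
    AlgebraicIndependent ℂ (glFamily f) := by
  -- The position `(i - 1 - j, i - 1)` lies in the last column of the `i`-th corner, `j` above the
  -- diagonal. Cutting off the curve gives the same formula in the smaller size.
  have hderiv : ∀ p q : Σ i : Set.Icc 1 n, Fin (glRank i), HasDerivAt (fun t : ℂ =>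
      glFamily (fun i : Set.Icc 1 n => glGenerator i) p (tridiagonal n +
        t • matrixUnit n ((q.1 : ℕ) - 1 - q.2) ((q.1 : ℕ) - 1)))
      (((p.2 : ℕ) + 1) * (tridiagonal p.1 ^ (p.2 : ℕ) *
        matrixUnit p.1 ((q.1 : ℕ) - 1 - q.2) ((q.1 : ℕ) - 1)).trace) 0 := fun p q =>
    hasDerivAt_trace_pow (p.2 : ℕ) (tridiagonal p.1) _
  refine algebraicIndependent_of_triangular_jacobian lexKey lexKey_injective (glFamily f)
    (glFamily fun i : Set.Icc 1 n => glGenerator i)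
    (fun p => comp_linearMap_mem_polynomialFunctions (hf p.1 p.2) (glCutoffLinear p.1.2.2))
    (fun p => comp_mem_adjoin (glCutoff p.1.2.2) (fun j => ⟨⟨p.1, j⟩, rfl⟩) (hgen p.1 p.2))
    (tridiagonal n) (fun q => matrixUnit n ((q.1 : ℕ) - 1 - q.2) ((q.1 : ℕ) - 1)) ?_ ?_
  · intro p q hpq
    refine (hderiv p q).congr_deriv ?_
    have hq : (q.2 : ℕ) < q.1 := q.2.is_lt
    rcases lexKey_lt hpq with h | ⟨h, h'⟩
    · rw [matrixUnit_eq_zero_right (by omega), mul_zero, Matrix.trace_zero, mul_zero]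
    · rw [trace_mul_matrixUnit _ ⟨(q.1 : ℕ) - 1 - q.2, by omega⟩ ⟨(q.1 : ℕ) - 1, by omega⟩,
        tridiagonal_pow_apply_comm, tridiagonal_pow_apply_eq_zero (by simp only; omega), mul_zero,
        mul_zero]
  · intro p
    have hp : (p.2 : ℕ) < p.1 := p.2.is_lt
    refine ⟨_, ?_, hderiv p p⟩
    rw [trace_mul_matrixUnit _ ⟨(p.1 : ℕ) - 1 - p.2, by omega⟩ ⟨(p.1 : ℕ) - 1, by omega⟩,
      tridiagonal_pow_apply_comm, tridiagonal_pow_apply_eq_one (by simp only; omega), mul_one]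
    exact mul_ne_zero (Nat.cast_add_one_ne_zero _) (by simp)

/-- The matrix `tridiagonal n` as an element of `𝔰𝔬(n)`. -/
def soTridiagonal (n : ℕ) : so n :=
  ⟨tridiagonal n, (LieAlgebra.Orthogonal.mem_so _ _ _).2 (transpose_tridiagonal n)⟩

/-- The element `E_{a, b} - E_{b, a}` of `𝔰𝔬(n)`. -/
def soUnit (n a b : ℕ) : so n :=
  ⟨matrixUnit n a b - matrixUnit n b a, (LieAlgebra.Orthogonal.mem_so _ _ _).2 (by
    rw [Matrix.transpose_sub, transpose_matrixUnit, transpose_matrixUnit, neg_sub])⟩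

/-- The derivative of `tr (x ^ (2 j + 2))` on `𝔰𝔬(n)` at the tridiagonal point. -/
theorem hasDerivAt_soTrace {n : ℕ} (j : ℕ) (a b : Fin n) :
    HasDerivAt (fun t : ℂ => ((tridiagonal n + t • (matrixUnit n a b - matrixUnit n b a)) ^
      (2 * (j + 1))).trace)
      ((2 * j + 2) * (-2 * (tridiagonal n ^ (2 * j + 1)) a b)) 0 := by
  refine (hasDerivAt_trace_pow (2 * j + 1) (tridiagonal n) _).congr_deriv ?_
  -- Odd powers of `T` are skew, so the two entries add up instead of cancelling.
  rw [mul_sub, Matrix.trace_sub, trace_mul_matrixUnit, trace_mul_matrixUnit,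
    tridiagonal_pow_apply_comm (2 * j + 1) a b, Odd.neg_one_pow ⟨j, rfl⟩]
  push_cast
  ring

/-- Polynomial functions `f i j` on the `𝔰𝔬(i)` are algebraically independent if they generate
functions `b i j`, each of which is the trace of `x ^ (2 j + 2)` or, for the last `j` when `i` is
even, the Pfaffian. -/
theorem algebraicIndependent_soFamily {n : ℕ}
    (f b : (i : Set.Icc 1 n) → Fin (soRank i) → so i → ℂ)
    (hf : ∀ (i : Set.Icc 1 n) j, f i j ∈ polynomialFunctions (so i))
    (hgen : ∀ (i : Set.Icc 1 n) j, b i j ∈ Algebra.adjoin ℂ (Set.range (f i)))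
    (hb : ∀ (i : Set.Icc 1 n) j, (b i j = fun x : so i => ((x : gl i) ^ (2 * ((j : ℕ) + 1))).trace) ∨
      Even (i : ℕ) ∧ (j : ℕ) + 1 = soRank i ∧ b i j = fun x : so i => pfaffian (x : gl i)) :
    AlgebraicIndependent ℂ (soFamily f) := by
  have hcut : ∀ (p : Σ i : Set.Icc 1 n, Fin (soRank i)) (a c : ℕ) (t : ℂ),
      soCutoff p.1.2.2 (soTridiagonal n + t • soUnit n a c) =
        soTridiagonal p.1 + t • soUnit p.1 a c := fun p a c t => rfl
  have hrank : ∀ q : Σ i : Set.Icc 1 n, Fin (soRank i), 2 * (q.2 : ℕ) + 2 ≤ q.1 := fun q => by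
    have : (q.2 : ℕ) < (q.1 : ℕ) / 2 := q.2.is_lt
    omega
  refine algebraicIndependent_of_triangular_jacobian lexKey lexKey_injective (soFamily f)
    (soFamily b)
    (fun p => comp_linearMap_mem_polynomialFunctions (hf p.1 p.2) (soCutoffLinear p.1.2.2))
    (fun p => comp_mem_adjoin (soCutoff p.1.2.2) (fun j => ⟨⟨p.1, j⟩, rfl⟩) (hgen p.1 p.2))
    -- The offset `2 j + 1` matches the power of `T` in the derivative of `tr (x ^ (2 j + 2))`. For
    -- `i = 2 l` and the last `j` the position is `(0, i - 1)`, as the Pfaffian requires.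
    (soTridiagonal n) (fun q => soUnit n ((q.1 : ℕ) - 1 - (2 * q.2 + 1)) ((q.1 : ℕ) - 1)) ?_ ?_
  · intro p q hpq
    simp only [soFamily, hcut]
    have hq := hrank q
    rcases lexKey_lt hpq with h | ⟨h, h'⟩
    · have hzero : soUnit p.1 ((q.1 : ℕ) - 1 - (2 * q.2 + 1)) ((q.1 : ℕ) - 1) = 0 := by
        apply Subtype.ext
        simp only [soUnit]
        rw [matrixUnit_eq_zero_right (by omega), matrixUnit_eq_zero_left (by omega), sub_zero]
        rfl
      simp only [hzero, smul_zero, add_zero]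
      exact hasDerivAt_const _ _
    · rcases hb p.1 p.2 with hp | ⟨-, hp, -⟩
      · rw [hp]
        have hd := hasDerivAt_soTrace (n := p.1) (p.2 : ℕ)
          ⟨(q.1 : ℕ) - 1 - (2 * q.2 + 1), by omega⟩ ⟨(q.1 : ℕ) - 1, by omega⟩
        rw [tridiagonal_pow_apply_eq_zero (by simp only; omega), mul_zero, mul_zero] at hd
        exact hd
      -- The Pfaffian has the last index of its `i`, so no `q` with the same `i` comes later.
      · have h1 : (q.2 : ℕ) < (q.1 : ℕ) / 2 := q.2.is_lt
        have h2 : (p.2 : ℕ) + 1 = (p.1 : ℕ) / 2 := hp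
        omega
  · intro p
    simp only [soFamily, hcut]
    have hr := hrank p
    rcases hb p.1 p.2 with hp | ⟨heven, hlast, hp⟩
    · rw [hp]
      have hd := hasDerivAt_soTrace (n := p.1) (p.2 : ℕ)
        ⟨(p.1 : ℕ) - 1 - (2 * p.2 + 1), by omega⟩ ⟨(p.1 : ℕ) - 1, by omega⟩
      rw [tridiagonal_pow_apply_eq_one (by simp only; omega), mul_one] at hd
      refine ⟨_, mul_ne_zero ?_ (by norm_num), hd⟩
      exact_mod_cast (by omega : 2 * (p.2 : ℕ) + 2 ≠ 0)
    · rw [hp]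
      obtain ⟨d, hd, hd'⟩ := exists_hasDerivAt_pfaffian heven (by omega)
      refine ⟨d, hd, ?_⟩
      have h1 : (p.2 : ℕ) + 1 = (p.1 : ℕ) / 2 := hlast
      have h2 := heven.two_dvd
      rw [show (p.1 : ℕ) - 1 - (2 * p.2 + 1) = 0 by omega]
      exact hd'

end GelfandZeitlin

theorem corollary3p2 (n : ℕ) :
    -- the case of `𝔤𝔩(n)`: arbitrary generators, and the chosen ones
    ((∀ f : (i : Set.Icc 1 n) → Fin (GelfandZeitlin.glRank i) → GelfandZeitlin.gl i → ℂ,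
        (∀ i, Algebra.adjoin ℂ (Set.range (f i)) = GelfandZeitlin.glInvariants i) →
        AlgebraicIndependent ℂ (GelfandZeitlin.glFamily f)) ∧
      AlgebraicIndependent ℂ
        (GelfandZeitlin.glFamily fun i : Set.Icc 1 n => GelfandZeitlin.glGenerator i)) ∧
    -- the case of `𝔰𝔬(n)`: arbitrary generators, and the chosen ones
    ((∀ f : (i : Set.Icc 1 n) → Fin (GelfandZeitlin.soRank i) → GelfandZeitlin.so i → ℂ,
        (∀ i, Algebra.adjoin ℂ (Set.range (f i)) = GelfandZeitlin.soInvariants i) →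
        AlgebraicIndependent ℂ (GelfandZeitlin.soFamily f)) ∧
      AlgebraicIndependent ℂ
        (GelfandZeitlin.soFamily fun i : Set.Icc 1 n => GelfandZeitlin.soGenerator i)) := by
  open GelfandZeitlin in
  refine ⟨⟨fun f hf => ?_, ?_⟩, fun f hf => ?_, ?_⟩
  · refine algebraicIndependent_glFamily f (fun i j => ?_) fun i j => ?_
    · have h : f i j ∈ glInvariants i := hf i ▸ Algebra.subset_adjoin ⟨j, rfl⟩
      exact h.1
    · rw [hf i]
      exact glGenerator_mem_glInvariants i j
  · exact algebraicIndependent_glFamily _ (fun i j => (glGenerator_mem_glInvariants i j).1)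
      fun i j => Algebra.subset_adjoin ⟨j, rfl⟩
  -- For even `i` the trace of `x ^ i` replaces the Pfaffian, whose invariance is thus not needed.
  · refine algebraicIndependent_soFamily f
      (fun i j x => ((x : gl i) ^ (2 * ((j : ℕ) + 1))).trace) (fun i j => ?_) (fun i j => ?_)
      fun i j => Or.inl rfl
    · have h : f i j ∈ soInvariants i := hf i ▸ Algebra.subset_adjoin ⟨j, rfl⟩
      exact h.1
    · rw [hf i]
      exact soTrace_mem_soInvariants i _
  · have hgen : ∀ (i : Set.Icc 1 n) (j : Fin (soRank i)),
        (soGenerator i j = fun x : so i => ((x : gl i) ^ (2 * ((j : ℕ) + 1))).trace) ∨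
        Even (i : ℕ) ∧ (j : ℕ) + 1 = soRank i ∧
          soGenerator i j = fun x : so i => pfaffian (x : gl i) := fun i j => by
      by_cases h : Even (i : ℕ) ∧ (j : ℕ) + 1 = soRank i
      · exact Or.inr ⟨h.1, h.2, funext fun x => if_pos h⟩
      · exact Or.inl (funext fun x => if_neg h)
    -- Here `b = f`, so only polynomiality of the generators remains.
    refine algebraicIndependent_soFamily _ _ (fun i j => ?_)
      (fun i j => Algebra.subset_adjoin ⟨j, rfl⟩) hgen
    rcases hgen i j with h | ⟨-, -, h⟩
    · rw [h]
      exact (soTrace_mem_soInvariants i _).1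
    · rw [h]
      exact comp_linearMap_mem_polynomialFunctions (pfaffian_mem_polynomialFunctions i)
        (soInclusion i)
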